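/- Let $d\ge 1$ be an integer. A measurable $k$-coloring of $\mathbb{R}^d$ is a map $f:\mathbb{R}^d\to\{1,\dots,k\}$ such that each set $f^{-1}(i)$ is Lebesgue measurable. It distinguishes axis-aligned cubes if there are no two distinct nontrivial axis-aligned cubes $A\neq B$ (sets of the form $[a_1,a_1+s]\times\dots\times[a_d,a_d+s]$ with $s>0$) such that $\mathcal{L}(A\cap f^{-1}(i))=\mathcal{L}(B\cap f^{-1}(i))$ for every color $i$, where $\mathcal{L}$ is Lebesgue measure. Let $\mathcal{M}$ be the metric space of measurable $(2d+3)$-colorings of $\mathbb{R}^d$ with the distance $$\rho(f,g)=\sum_{n=1}^{\infty}\frac{1}{2^n}\cdot\frac{\mathcal{L}(\{x\in[-n,n]^d: f(x)\neq g(x)\})}{(2n)^d},$$ where colorings at distance zero (those that agree almost everywhere) are identified; distinguishing axis-aligned cubes is well defined on $\mathcal{M}$. Then there exists a measurable $(2d+3)$-coloring of $\mathbb{R}^d$ that distinguishes axis-aligned cubes, and the set of such colorings is dense in $\mathcal{M}$. -/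

import Mathlib

open MeasureTheory

noncomputable section

namespace CubeColoring

/-- A measurable `k`-coloring of `ℝ^d`: a map to a set of `k` colors whose color classes are all
Lebesgue measurable (that is, null measurable with respect to `volume`). -/
structure Coloring (d k : ℕ) where
  toFun : (Fin d → ℝ) → Fin k
  measurable_class : ∀ i : Fin k, NullMeasurableSet (toFun ⁻¹' {i}) volume

/-- The box `[-r, r]^d`. -/
def box (d : ℕ) (r : ℝ) : Set (Fin d → ℝ) := Set.Icc (fun _ => -r) (fun _ => r)

/-- The points of `[-n, n]^d` at which two colorings differ. -/
def diffSet {d k : ℕ} (n : ℕ) (f g : Coloring d k) : Set (Fin d → ℝ) :=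
  {x | x ∈ box d n ∧ f.toFun x ≠ g.toFun x}

/-- The normalized distance of two colorings on `[-n, n]^d`. -/
def distOn {d k : ℕ} (n : ℕ) (f g : Coloring d k) : ℝ :=
  volume.real (diffSet n f g) / (2 * (n : ℝ)) ^ d

/-- The distance `∑_{n ≥ 1} d_n(f, g) / 2^n` of two colorings. -/
def colorDist {d k : ℕ} (f g : Coloring d k) : ℝ :=
  ∑' n : ℕ, distOn (n + 1) f g / 2 ^ (n + 1)

lemma volume_box (d n : ℕ) : volume (box d n) = ENNReal.ofReal ((2 * (n : ℝ)) ^ d) := by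
  simp only [box, Real.volume_Icc_pi, Finset.prod_const, Finset.card_univ, Fintype.card_fin]
  rw [ENNReal.ofReal_pow (by positivity)]
  congr 2
  ring

lemma volume_box_ne_top (d n : ℕ) : volume (box d n) ≠ ⊤ := by
  rw [volume_box]; exact ENNReal.ofReal_ne_top

lemma volume_diffSet_ne_top {d k : ℕ} (n : ℕ) (f g : Coloring d k) :
    volume (diffSet n f g) ≠ ⊤ :=
  ((measure_mono fun _ hx => hx.1).trans_lt (volume_box_ne_top d n).lt_top).ne

lemma distOn_nonneg {d k : ℕ} (n : ℕ) (f g : Coloring d k) : 0 ≤ distOn n f g := by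
  unfold distOn; positivity

lemma distOn_le_one {d k : ℕ} (n : ℕ) (f g : Coloring d k) : distOn n f g ≤ 1 := by
  refine div_le_one_of_le₀ ?_ (by positivity)
  have h : volume.real (diffSet n f g) ≤ volume.real (box d n) :=
    measureReal_mono (fun _ hx => hx.1) (volume_box_ne_top d n)
  have hb : volume.real (box d n) = (2 * (n : ℝ)) ^ d := by
    rw [Measure.real, volume_box, ENNReal.toReal_ofReal (by positivity)]
  exact h.trans hb.le

lemma distOn_triangle {d k : ℕ} (n : ℕ) (f g h : Coloring d k) :
    distOn n f h ≤ distOn n f g + distOn n g h := by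
  unfold distOn
  rw [← add_div]
  refine div_le_div_of_nonneg_right ?_ (by positivity)
  refine (measureReal_mono (s₂ := diffSet n f g ∪ diffSet n g h) ?_ ?_).trans
    (measureReal_union_le _ _)
  · rintro x ⟨hx, hne⟩
    by_cases hfg : f.toFun x = g.toFun x
    · exact Or.inr ⟨hx, hfg ▸ hne⟩
    · exact Or.inl ⟨hx, hfg⟩
  · exact measure_union_ne_top (volume_diffSet_ne_top n f g) (volume_diffSet_ne_top n g h)

lemma summable_distOn {d k : ℕ} (f g : Coloring d k) :
    Summable fun n : ℕ => distOn (n + 1) f g / 2 ^ (n + 1) := by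
  have hs : Summable fun n : ℕ => ((1 : ℝ) / 2) ^ (n + 1) :=
    (summable_nat_add_iff 1).2 summable_geometric_two
  refine Summable.of_nonneg_of_le (fun n => div_nonneg (distOn_nonneg _ f g) (by positivity))
    (fun n => ?_) hs
  rw [one_div_pow]
  exact div_le_div_of_nonneg_right (distOn_le_one _ f g) (by positivity)

instance (d k : ℕ) : PseudoMetricSpace (Coloring d k) where
  dist := colorDist
  dist_self f := by simp [colorDist, distOn, diffSet]
  dist_comm f g := by simp only [colorDist, distOn, diffSet, ne_comm]
  dist_triangle f g h := by
    unfold colorDist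
    rw [← (summable_distOn f g).tsum_add (summable_distOn g h)]
    refine (summable_distOn f h).tsum_le_tsum (fun n => ?_)
      ((summable_distOn f g).add (summable_distOn g h))
    rw [← add_div]
    exact div_le_div_of_nonneg_right (distOn_triangle _ f g h) (by positivity)

/-- The metric space of measurable `k`-colorings of `ℝ^d`, in which colorings at distance zero
are identified. -/
abbrev ColoringSpace (d k : ℕ) : Type := SeparationQuotient (Coloring d k)

/-- A nontrivial axis-aligned cube `[a₁, a₁ + s] × ⋯ × [a_d, a_d + s]` with `s > 0`. -/
def IsCube {d : ℕ} (A : Set (Fin d → ℝ)) : Prop :=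
  ∃ (a : Fin d → ℝ) (s : ℝ), 0 < s ∧ A = Set.Icc a (fun i => a i + s)

/-- No two distinct nontrivial axis-aligned cubes contain the same measure of every color. -/
def DistinguishesCubes {d k : ℕ} (f : Coloring d k) : Prop :=
  ∀ A B : Set (Fin d → ℝ), IsCube A → IsCube B →
    (∀ i : Fin k, volume (A ∩ f.toFun ⁻¹' {i}) = volume (B ∩ f.toFun ⁻¹' {i})) → A = B

lemma ae_eq_of_dist_eq_zero {d k : ℕ} {f g : Coloring d k} (h : dist f g = 0) :
    f.toFun =ᵐ[volume] g.toFun := by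
  have hz : ∀ n : ℕ, volume (diffSet (n + 1) f g) = 0 := by
    intro n
    have h0 := (hasSum_zero_iff_of_nonneg
      (fun n => div_nonneg (distOn_nonneg _ f g) (by positivity))).1
      (h ▸ (summable_distOn f g).hasSum :
        HasSum (fun n : ℕ => distOn (n + 1) f g / 2 ^ (n + 1)) 0)
    have h1 := congrFun h0 n
    have h2 : volume.real (diffSet (n + 1) f g) = 0 := by
      have hn : ((n : ℝ) + 1) ≠ 0 := by positivity
      simpa [distOn, hn] using h1
    exact (measureReal_eq_zero_iff (volume_diffSet_ne_top _ f g)).1 h2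
  refine measure_mono_null ?_ (measure_iUnion_null hz)
  intro x hx
  obtain ⟨n, hn⟩ := exists_nat_ge ‖x‖
  refine Set.mem_iUnion.2 ⟨n, ⟨?_, ?_⟩, hx⟩ <;> intro i <;>
    have hi := abs_le.1 ((norm_le_pi_norm x i).trans hn) <;> push_cast <;> linarith [hi.1, hi.2]

lemma distinguishesCubes_of_dist_eq_zero {d k : ℕ} {f g : Coloring d k} (h : dist f g = 0)
    (hf : DistinguishesCubes f) : DistinguishesCubes g := by
  intro A B hA hB hAB
  have key : ∀ (C : Set (Fin d → ℝ)) (i : Fin k),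
      volume (C ∩ f.toFun ⁻¹' {i}) = volume (C ∩ g.toFun ⁻¹' {i}) := by
    intro C i
    refine measure_congr ?_
    filter_upwards [ae_eq_of_dist_eq_zero h] with x hx
    have : (x ∈ C ∩ f.toFun ⁻¹' {i}) = (x ∈ C ∩ g.toFun ⁻¹' {i}) := by simp [hx]
    exact this
  exact hf A B hA hB fun i => by rw [key, key, hAB i]

/-- The property of distinguishing cubes for elements of the metric space of colorings (it does
not depend on the representative). -/
def ColoringSpace.Distinguishes {d k : ℕ} (F : ColoringSpace d k) : Prop :=
  SeparationQuotient.lift (fun f : Coloring d k => DistinguishesCubes f)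
    (fun f g hfg => by
      have h : dist f g = 0 := Metric.inseparable_iff.1 hfg
      exact propext ⟨distinguishesCubes_of_dist_eq_zero h,
        distinguishesCubes_of_dist_eq_zero (dist_comm f g ▸ h)⟩) F

end CubeColoring

end

namespace CubeColoring

open Filter Topology

/-! The proof is a Baire category argument in the complete space of colorings. The color volumes of
a cube add up to its volume, so only pairs of cubes of equal side matter. Such a pair has `2 * d +
1` real parameters. The pairs are exhausted by the families `Separated n`. For each `n`, the
colorings that distinguish this family with a uniform gap form an open set
(`isOpen_uniformlyDistinguishing`). The intersection of these sets consists of distinguishing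
colorings (`distinguishesCubes_of_forall_mem`).

Density (`dense_uniformlyDistinguishing`) is a count of dimensions. On each of finitely many grid
cells, the volumes of all colors but the last can be adjusted independently by a small perturbation,
in `M` steps each (`exists_perturbation`). This gives `2 * d + 2` parameters per cell, one more than
a pair of cubes has. If every perturbation failed, its bad pair, rounded to precision of order `1 /
M`, and its parameters off one cell that lies in the first cube and misses the second would
determine the perturbation. For large `M` there are too few such codes (`exists_code_collision`). -/

/-- The volume of the part of `A` that has color `i`. -/
noncomputable def colorVol {d k : ℕ} (f : Coloring d k) (i : Fin k) (A : Set (Fin d → ℝ)) : ℝ :=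
  volume.real (A ∩ f.toFun ⁻¹' {i})

/-- The cube with smallest vertex `a` and side length `s`. -/
def cube {d : ℕ} (a : Fin d → ℝ) (s : ℝ) : Set (Fin d → ℝ) := Set.Icc a (fun i => a i + s)

/-! ### Completeness of the space of colorings -/

lemma volume_diffSet_le_dist {d k : ℕ} (m : ℕ) (f g : Coloring d k) :
    volume.real (diffSet (m + 1) f g) ≤ (2 * ((m : ℝ) + 1)) ^ d * 2 ^ (m + 1) * dist f g := by
  have h := (summable_distOn f g).le_tsum m
    (fun j _ => div_nonneg (distOn_nonneg _ f g) (by positivity))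
  change _ ≤ dist f g at h
  unfold distOn at h
  push_cast at h
  rw [div_div, div_le_iff₀ (by positivity)] at h
  linarith

/-- The normalizing factors are at least 1 and the weights of the series sum to 1. -/
lemma dist_le_volume {d k : ℕ} {f g : Coloring d k} {W : Set (Fin d → ℝ)}
    (hW : volume W ≠ ⊤) (h : ∀ x, x ∉ W → f.toFun x = g.toFun x) :
    dist f g ≤ volume.real W := by
  have hle : ∀ n : ℕ, distOn (n + 1) f g ≤ volume.real W := by
    intro n
    have h1 : volume.real (diffSet (n + 1) f g) ≤ volume.real W :=
      measureReal_mono (fun x hx => by_contra fun hxW => hx.2 (h x hxW)) hW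
    refine (div_le_self measureReal_nonneg (one_le_pow₀ ?_)).trans h1
    push_cast
    linarith [(Nat.cast_nonneg n : (0 : ℝ) ≤ n)]
  have hs : HasSum (fun n : ℕ => volume.real W / 2 ^ (n + 1)) (volume.real W) := by
    convert hasSum_geometric_two' (volume.real W) using 2 with n
    rw [pow_succ']; field_simp
  change ∑' n : ℕ, distOn (n + 1) f g / 2 ^ (n + 1) ≤ _
  rw [← hs.tsum_eq]
  exact (summable_distOn f g).tsum_le_tsum
    (fun n => div_le_div_of_nonneg_right (hle n) (by positivity)) hs.summable

/-- A sequence of colorings whose consecutive terms are geometrically close is eventually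
constant at almost every point. -/
lemma ae_eventually_eq_succ {d k : ℕ} {u : ℕ → Coloring d k}
    (hu : ∀ n, dist (u n) (u (n + 1)) ≤ (1 / 2) ^ n) :
    ∀ᵐ x : Fin d → ℝ, ∀ᶠ n in atTop, (u n).toFun x = (u (n + 1)).toFun x := by
  have hK : ∀ K : ℕ, ∀ᵐ x : Fin d → ℝ, ∀ᶠ n in atTop,
      x ∉ diffSet (K + 1) (u n) (u (n + 1)) := by
    intro K
    refine ae_eventually_notMem ?_
    set C : ℝ := (2 * ((K : ℝ) + 1)) ^ d * 2 ^ (K + 1)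
    have hC : 0 ≤ C := by positivity
    have hsum : Summable fun n : ℕ => C * (1 / 2 : ℝ) ^ n :=
      summable_geometric_two.mul_left C
    refine ne_top_of_le_ne_top hsum.tsum_ofReal_ne_top (ENNReal.tsum_le_tsum fun n => ?_)
    rw [← ENNReal.ofReal_toReal (volume_diffSet_ne_top (K + 1) (u n) (u (n + 1)))]
    exact ENNReal.ofReal_le_ofReal ((volume_diffSet_le_dist K _ _).trans
      (mul_le_mul_of_nonneg_left (hu n) hC))
  filter_upwards [ae_all_iff.2 hK] with x hx
  obtain ⟨K, hxK⟩ := exists_nat_ge ‖x‖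
  filter_upwards [hx K] with n hn
  by_contra hne
  refine hn ⟨⟨?_, ?_⟩, hne⟩ <;> intro i <;>
    have hi := abs_le.1 ((norm_le_pi_norm x i).trans hxK) <;> push_cast <;> linarith [hi.1, hi.2]

open Classical in
/-- The pointwise limit of a sequence of maps to colors, where it is eventually constant. -/
noncomputable def limitColor {α : Type*} {k : ℕ} (u : ℕ → α → Fin k) (x : α) : Fin k :=
  if h : ∃ c, ∀ᶠ n in atTop, u n x = c then h.choose else u 0 x

lemma eventually_eq_limitColor {α : Type*} {k : ℕ} {u : ℕ → α → Fin k} {x : α}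
    (h : ∀ᶠ n in atTop, u n x = u (n + 1) x) : ∀ᶠ n in atTop, u n x = limitColor u x := by
  have h' : ∃ c, ∀ᶠ n in atTop, u n x = c := by
    obtain ⟨N, hN⟩ := eventually_atTop.1 h
    refine ⟨u N x, eventually_atTop.2 ⟨N, fun n hn => ?_⟩⟩
    induction n, hn using Nat.le_induction with
    | base => rfl
    | succ n hn ih => rw [← hN n hn, ih]
  rw [limitColor, dif_pos h']
  exact h'.choose_spec

/-- The almost everywhere limit of a geometrically convergent sequence of colorings. -/
noncomputable def limitColoring {d k : ℕ} (u : ℕ → Coloring d k)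
    (hu : ∀ n, dist (u n) (u (n + 1)) ≤ (1 / 2) ^ n) : Coloring d k where
  toFun := limitColor fun n => (u n).toFun
  measurable_class i := by
    have hm : NullMeasurableSet (⋃ N : ℕ, ⋂ n : ℕ, (u (N + n)).toFun ⁻¹' {i}) volume :=
      .iUnion fun N => .iInter fun n => (u (N + n)).measurable_class i
    refine hm.congr ?_
    filter_upwards [ae_eventually_eq_succ hu] with x hx
    obtain ⟨N, hN⟩ := eventually_atTop.1 (eventually_eq_limitColor (u := fun n => (u n).toFun) hx)
    refine propext ?_
    change x ∈ (⋃ N : ℕ, ⋂ n : ℕ, (u (N + n)).toFun ⁻¹' {i}) ↔ limitColor (fun n => (u n).toFun) x = i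
    simp only [Set.mem_iUnion, Set.mem_iInter, Set.mem_preimage, Set.mem_singleton_iff]
    constructor
    · rintro ⟨N', h'⟩
      rw [← hN (N' + N) (by omega), h' N]
    · intro h
      exact ⟨N, fun n => by rw [hN (N + n) (by omega), h]⟩

/-- At almost every point, differing from the limit forces a change of color at some later step. The
bound sums the geometric tail of these changes. -/
lemma volume_diffSet_limitColoring_le {d k : ℕ} (u : ℕ → Coloring d k)
    (hu : ∀ n, dist (u n) (u (n + 1)) ≤ (1 / 2) ^ n) (K n : ℕ) :
    volume.real (diffSet (K + 1) (u n) (limitColoring u hu)) ≤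
      (2 * ((K : ℝ) + 1)) ^ d * 2 ^ (K + 1) * (2 * (1 / 2) ^ n) := by
  set C : ℝ := (2 * ((K : ℝ) + 1)) ^ d * 2 ^ (K + 1)
  have hC : 0 ≤ C := by positivity
  have hs : HasSum (fun m : ℕ => C * (1 / 2 : ℝ) ^ (n + m)) (C * (2 * (1 / 2) ^ n)) := by
    refine HasSum.mul_left C ?_
    simp_rw [pow_add, mul_comm ((1 / 2 : ℝ) ^ n)]
    exact hasSum_geometric_two.mul_right _
  have hle : volume (diffSet (K + 1) (u n) (limitColoring u hu)) ≤
      ∑' m : ℕ, volume (diffSet (K + 1) (u (n + m)) (u (n + m + 1))) := by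
    refine (measure_mono_ae ?_).trans (measure_iUnion_le _)
    filter_upwards [ae_eventually_eq_succ hu] with x hx hxd
    obtain ⟨N, hN⟩ := eventually_atTop.1 (eventually_eq_limitColor (u := fun n => (u n).toFun) hx)
    by_contra hne
    have hne' : ∀ m, (u (n + m)).toFun x = (u (n + m + 1)).toFun x := by
      intro m
      by_contra hm
      exact hne (Set.mem_iUnion.2 ⟨m, hxd.1, hm⟩)
    have hall : ∀ m, (u (n + m)).toFun x = (u n).toFun x := by
      intro m
      induction m with
      | zero => rfl
      | succ m ih => rw [← ih]; exact (hne' m).symm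
    exact hxd.2 ((hall N).symm.trans (hN (n + N) (by omega)))
  have hle2 : volume (diffSet (K + 1) (u n) (limitColoring u hu)) ≤
      ENNReal.ofReal (C * (2 * (1 / 2) ^ n)) := by
    rw [← hs.tsum_eq, ENNReal.ofReal_tsum_of_nonneg (fun m => by positivity) hs.summable]
    refine hle.trans (ENNReal.tsum_le_tsum fun m => ?_)
    rw [← ENNReal.ofReal_toReal (volume_diffSet_ne_top (K + 1) (u (n + m)) (u (n + m + 1)))]
    exact ENNReal.ofReal_le_ofReal ((volume_diffSet_le_dist K _ _).trans
      (mul_le_mul_of_nonneg_left (hu _) hC))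
  exact ENNReal.toReal_le_of_le_ofReal (by positivity) hle2

/-- Dominated convergence for the series defining the distance: each term tends to zero, and the
weights dominate. -/
lemma tendsto_limitColoring {d k : ℕ} (u : ℕ → Coloring d k)
    (hu : ∀ n, dist (u n) (u (n + 1)) ≤ (1 / 2) ^ n) :
    Tendsto u atTop (𝓝 (limitColoring u hu)) := by
  rw [tendsto_iff_dist_tendsto_zero]
  change Tendsto (fun n => ∑' K : ℕ, distOn (K + 1) (u n) (limitColoring u hu) / 2 ^ (K + 1))
    atTop (𝓝 0)
  have hs : Summable fun n : ℕ => ((1 : ℝ) / 2) ^ (n + 1) :=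
    (summable_nat_add_iff 1).2 summable_geometric_two
  have hpt : ∀ K : ℕ, Tendsto
      (fun n => distOn (K + 1) (u n) (limitColoring u hu) / 2 ^ (K + 1)) atTop (𝓝 0) := by
    intro K
    have hv : Tendsto (fun n => volume.real (diffSet (K + 1) (u n) (limitColoring u hu)))
        atTop (𝓝 0) := by
      refine squeeze_zero (fun _ => measureReal_nonneg)
        (volume_diffSet_limitColoring_le u hu K) ?_
      have := ((tendsto_pow_atTop_nhds_zero_of_lt_one (r := (1 / 2 : ℝ)) (by norm_num)
        (by norm_num)).const_mul 2).const_mul ((2 * ((K : ℝ) + 1)) ^ d * 2 ^ (K + 1))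
      simpa using this
    have := (hv.div_const ((2 * ((K + 1 : ℕ) : ℝ)) ^ d)).div_const (2 ^ (K + 1))
    rw [zero_div, zero_div] at this
    exact this
  have := tendsto_tsum_of_dominated_convergence hs hpt (Eventually.of_forall fun n K => ?_)
  · simpa using this
  · rw [Real.norm_of_nonneg (div_nonneg (distOn_nonneg _ _ _) (by positivity)), one_div_pow]
    exact div_le_div_of_nonneg_right (distOn_le_one _ _ _) (by positivity)

instance completeSpace_coloring (d k : ℕ) : CompleteSpace (Coloring d k) :=
  Metric.complete_of_convergent_controlled_sequences (fun n => (1 / 2) ^ n)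
    (fun n => by positivity) fun u hu =>
      ⟨_, tendsto_limitColoring u fun n => (hu n n (n + 1) le_rfl (Nat.le_succ n)).le⟩

/-! ### Openness of uniform distinction -/

lemma colorVol_le_add_diffSet {d k K : ℕ} (f g : Coloring d k) (i : Fin k)
    {A : Set (Fin d → ℝ)} (hA : A ⊆ box d K) :
    colorVol f i A ≤ colorVol g i A + volume.real (diffSet K f g) := by
  have hfin : volume (A ∩ g.toFun ⁻¹' {i}) ≠ ⊤ :=
    measure_ne_top_of_subset (Set.inter_subset_left.trans hA) (volume_box_ne_top d K)
  refine (measureReal_mono (s₂ := (A ∩ g.toFun ⁻¹' {i}) ∪ diffSet K f g) ?_ ?_).trans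
    (measureReal_union_le _ _)
  · rintro x ⟨hx, hi⟩
    by_cases h : f.toFun x = g.toFun x
    · exact Or.inl ⟨hx, h.symm.trans hi⟩
    · exact Or.inr ⟨hA hx, h⟩
  · exact measure_union_ne_top hfin (volume_diffSet_ne_top K f g)

lemma abs_colorVol_sub_le {d k K : ℕ} (f g : Coloring d k) (i : Fin k)
    {A : Set (Fin d → ℝ)} (hA : A ⊆ box d ((K + 1 : ℕ) : ℝ)) :
    |colorVol f i A - colorVol g i A| ≤ (2 * ((K : ℝ) + 1)) ^ d * 2 ^ (K + 1) * dist f g := by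
  have h1 := colorVol_le_add_diffSet f g i hA
  have h2 := colorVol_le_add_diffSet g f i hA
  have h3 := volume_diffSet_le_dist K f g
  have h4 := volume_diffSet_le_dist K g f
  rw [dist_comm g f] at h4
  rw [abs_le]
  constructor <;> linarith

/-- Two cubes of the same side length `s ∈ [1/n, n]` with vertices in `[-n, n]^d` that differ by
at least `1/n` in some coordinate. -/
def Separated {d : ℕ} (n : ℕ) (a b : Fin d → ℝ) (s : ℝ) : Prop :=
  a ∈ box d n ∧ b ∈ box d n ∧ s ∈ Set.Icc (1 / (n : ℝ)) n ∧ ∃ j, a j + 1 / (n : ℝ) ≤ b j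

lemma cube_subset_box {d n : ℕ} {a : Fin d → ℝ} {s : ℝ} (ha : a ∈ box d n) (hs : s ≤ n) :
    cube a s ⊆ box d ((2 * n + 1 : ℕ) : ℝ) := by
  have hn : (0 : ℝ) ≤ n := n.cast_nonneg
  intro x hx
  refine ⟨fun i => ?_, fun i => ?_⟩
  · have := ha.1 i; have := hx.1 i
    push_cast; linarith
  · have := ha.2 i; have := hx.2 i
    push_cast; linarith

/-- The colorings that uniformly distinguish the separated pairs of cubes at scale `n`. -/
def uniformlyDistinguishing (d k n : ℕ) : Set (Coloring d k) :=
  {f | ∃ δ > 0, ∀ a b s, Separated n a b s →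
    ∃ i, δ ≤ |colorVol f i (cube a s) - colorVol f i (cube b s)|}

lemma isOpen_uniformlyDistinguishing (d k n : ℕ) :
    IsOpen (uniformlyDistinguishing d k n) := by
  rw [Metric.isOpen_iff]
  rintro f ⟨δ, hδ, hf⟩
  set C : ℝ := (2 * (((2 * n : ℕ) : ℝ) + 1)) ^ d * 2 ^ (2 * n + 1)
  have hC : 0 < C := by positivity
  -- Within this radius each of the two color volumes moves by at most `δ / 4`, so half of the gap
  -- survives.
  refine ⟨δ / (4 * C), by positivity, fun g hg => ⟨δ / 2, by positivity, fun a b s h => ?_⟩⟩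
  obtain ⟨i, hi⟩ := hf a b s h
  refine ⟨i, ?_⟩
  have h1 := abs_colorVol_sub_le g f i (cube_subset_box h.1 h.2.2.1.2)
  have h2 := abs_colorVol_sub_le g f i (cube_subset_box h.2.1 h.2.2.1.2)
  have h3 : C * dist g f ≤ δ / 4 := by
    have : dist g f ≤ δ / (4 * C) := (Metric.mem_ball.1 hg).le
    calc C * dist g f ≤ C * (δ / (4 * C)) := by gcongr
      _ = δ / 4 := by field_simp
  change _ ≤ C * dist g f at h1 h2
  rw [abs_le] at h1 h2
  rcases le_abs.1 hi with h4 | h4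
  · exact le_abs.2 (Or.inl (by linarith))
  · exact le_abs.2 (Or.inr (by linarith))

/-! ### Reduction to countably many open conditions -/

lemma volume_cube {d : ℕ} (a : Fin d → ℝ) {s : ℝ} (hs : 0 ≤ s) :
    volume.real (cube a s) = s ^ d := by
  rw [cube, Measure.real, Real.volume_Icc_pi_toReal (fun i => by simpa using hs)]
  simp

lemma measurableSet_cube {d : ℕ} (a : Fin d → ℝ) (s : ℝ) : MeasurableSet (cube a s) :=
  measurableSet_Icc

lemma volume_cube_ne_top {d : ℕ} (a : Fin d → ℝ) (s : ℝ) : volume (cube a s) ≠ ⊤ :=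
  isCompact_Icc.measure_ne_top

lemma sum_volume_color {d k : ℕ} (f : Coloring d k) {A : Set (Fin d → ℝ)}
    (hA : MeasurableSet A) : ∑ i, volume (A ∩ f.toFun ⁻¹' {i}) = volume A := by
  have h := measure_iUnion₀ (μ := volume) (f := fun i : Fin k => A ∩ f.toFun ⁻¹' {i})
    (fun i j hij => (Set.disjoint_left.2 fun x hx hx' =>
      hij (hx.2.symm.trans hx'.2)).aedisjoint)
    (fun i => hA.nullMeasurableSet.inter (f.measurable_class i))
  rw [tsum_fintype] at h
  rw [← h, ← Set.inter_iUnion]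
  congr 1
  ext x
  simp

lemma distinguishesCubes_of_forall_mem {d k : ℕ} (hd : 1 ≤ d) {f : Coloring d k}
    (hf : ∀ n, 1 ≤ n → f ∈ uniformlyDistinguishing d k n) : DistinguishesCubes f := by
  have key : ∀ (a b : Fin d → ℝ) (s : ℝ), 0 < s → (∃ j, a j < b j) →
      ∃ i, colorVol f i (cube a s) ≠ colorVol f i (cube b s) := by
    rintro a b s hs ⟨j, hj⟩
    obtain ⟨n, hn⟩ := exists_nat_ge (max (max ‖a‖ ‖b‖) (max s (max (1 / s) (1 / (b j - a j)))))
    simp only [max_le_iff] at hn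
    obtain ⟨⟨ha, hb⟩, h1, h2, h3⟩ := hn
    have hbox : ∀ c : Fin d → ℝ, ‖c‖ ≤ n → c ∈ box d n := fun c hc =>
      ⟨fun i => (abs_le.1 ((norm_le_pi_norm c i).trans hc)).1,
        fun i => (abs_le.1 ((norm_le_pi_norm c i).trans hc)).2⟩
    have hn0 : (0 : ℝ) < n := hs.trans_le h1
    obtain ⟨δ, hδ, h⟩ := hf n (by exact_mod_cast hn0)
    obtain ⟨i, hi⟩ := h a b s ⟨hbox a ha, hbox b hb, ⟨(one_div_le hs hn0).1 h2, h1⟩, j, by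
      linarith [(one_div_le (sub_pos.2 hj) hn0).1 h3]⟩
    refine ⟨i, fun heq => ?_⟩
    rw [heq, sub_self, abs_zero] at hi
    linarith
  rintro A B ⟨a, s, hs, rfl⟩ ⟨b, t, ht, rfl⟩ hAB
  -- Summing over the colors recovers the volume, and `d ≥ 1` recovers the side from it.
  have hst : s = t := by
    have hv : volume (cube a s) = volume (cube b t) := by
      rw [← sum_volume_color f (measurableSet_cube a s), ← sum_volume_color f (measurableSet_cube b t)]
      exact Finset.sum_congr rfl fun i _ => hAB i
    have hv' : s ^ d = t ^ d := by
      rw [← volume_cube a hs.le, ← volume_cube b ht.le, Measure.real, hv, Measure.real]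
    exact (pow_left_inj₀ hs.le ht.le (by omega)).1 hv'
  subst hst
  have hcol : ∀ i, colorVol f i (cube a s) = colorVol f i (cube b s) := fun i =>
    congrArg ENNReal.toReal (hAB i)
  suffices h : a = b by rw [h]
  by_contra hne
  obtain ⟨j, hj⟩ := Function.ne_iff.1 hne
  rcases lt_or_gt_of_ne hj with h | h
  · obtain ⟨i, hi⟩ := key a b s hs ⟨j, h⟩
    exact hi (hcol i)
  · obtain ⟨i, hi⟩ := key b a s hs ⟨j, h⟩
    exact hi (hcol i).symm

/-! ### Lipschitz dependence of color volumes on the cube -/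

/-- Both cubes lie in the cube of side `t + 3 * η` at `b - η`, whose excess volume over `cube b t`
is of order `η`. The constant is uniform in the coloring, so it can be fixed before the perturbation
is chosen. -/
lemma exists_colorVol_cube_le (d n : ℕ) : ∃ L : ℝ, 0 < L ∧
    ∀ (k : ℕ) (f : Coloring d k) (i : Fin k) (a b : Fin d → ℝ) (s t η : ℝ),
      0 ≤ t → t ≤ n → 0 ≤ η → η ≤ 1 → (∀ j, |a j - b j| ≤ η) → |s - t| ≤ η →
      colorVol f i (cube a s) ≤ colorVol f i (cube b t) + L * η := by
  refine ⟨3 * d * (n + 3) ^ (d - 1) + 1, by positivity, ?_⟩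
  intro k f i a b s t η ht htn hη hη1 hab hst
  set c : Fin d → ℝ := fun j => b j - η
  have hst' := abs_le.1 hst
  have hac : cube a s ⊆ cube c (t + 3 * η) := by
    intro x hx
    refine ⟨fun j => ?_, fun j => ?_⟩
    · have h1 := hx.1 j; have h2 := abs_le.1 (hab j)
      simp only [c]; linarith [h2.1]
    · have h1 := hx.2 j; have h2 := abs_le.1 (hab j)
      simp only [c] at h1 ⊢; linarith [h2.2, hst'.2]
  have hbc : cube b t ⊆ cube c (t + 3 * η) := by
    intro x hx
    refine ⟨fun j => ?_, fun j => ?_⟩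
    · have h1 := hx.1 j
      simp only [c]; linarith
    · have h1 := hx.2 j
      simp only [c] at h1 ⊢; linarith
  have hdiff : volume.real (cube c (t + 3 * η) \ cube b t) = (t + 3 * η) ^ d - t ^ d := by
    rw [measureReal_sdiff hbc (measurableSet_cube b t) (h₁ := volume_cube_ne_top _ _),
      volume_cube _ ht, volume_cube _ (by positivity)]
  have hpow : (t + 3 * η) ^ d - t ^ d ≤ 3 * d * (n + 3) ^ (d - 1) * η := by
    refine (le_abs_self _).trans ((abs_pow_sub_pow_le _ _ d).trans ?_)
    have h1 : |t + 3 * η - t| = 3 * η := by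
      rw [add_sub_cancel_left, abs_of_nonneg (by positivity)]
    have h2 : max |t + 3 * η| |t| ≤ n + 3 := by
      rw [abs_of_nonneg ht, abs_of_nonneg (by positivity : 0 ≤ t + 3 * η)]
      exact max_le (by linarith) (by linarith)
    rw [h1]
    calc 3 * η * d * max |t + 3 * η| |t| ^ (d - 1) ≤ 3 * η * d * (n + 3) ^ (d - 1) := by gcongr
      _ = _ := by ring
  have hmain : colorVol f i (cube a s) ≤
      colorVol f i (cube b t) + volume.real (cube c (t + 3 * η) \ cube b t) := by
    refine (measureReal_mono (s₂ := (cube b t ∩ f.toFun ⁻¹' {i}) ∪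
      (cube c (t + 3 * η) \ cube b t)) ?_ ?_).trans (measureReal_union_le _ _)
    · rintro x ⟨hx, hi⟩
      by_cases h : x ∈ cube b t
      · exact Or.inl ⟨h, hi⟩
      · exact Or.inr ⟨hac hx, h⟩
    · exact measure_union_ne_top
        (measure_ne_top_of_subset Set.inter_subset_left (volume_cube_ne_top _ _))
        (measure_ne_top_of_subset Set.sdiff_subset (volume_cube_ne_top _ _))
  rw [hdiff] at hmain
  linarith

/-! ### Grid cells separating two cubes -/

/-- The half-open cell of the grid `h ℤ^d` with smallest vertex `h z`. -/
def cell {d : ℕ} (h : ℝ) (z : Fin d → ℤ) : Set (Fin d → ℝ) :=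
  Set.pi Set.univ fun j => Set.Ico (z j * h) ((z j + 1) * h)

lemma measurableSet_cell {d : ℕ} (h : ℝ) (z : Fin d → ℤ) : MeasurableSet (cell h z) :=
  MeasurableSet.univ_pi fun _ => measurableSet_Ico

lemma volume_cell_ne_top {d : ℕ} (h : ℝ) (z : Fin d → ℤ) : volume (cell h z) ≠ ⊤ := by
  rw [cell, Real.volume_pi_Ico]
  exact ENNReal.prod_ne_top fun _ _ => ENNReal.ofReal_ne_top

lemma eq_of_mem_cell {d : ℕ} {h : ℝ} (hh : 0 < h) {z z' : Fin d → ℤ} {x : Fin d → ℝ}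
    (hx : x ∈ cell h z) (hx' : x ∈ cell h z') : z = z' := by
  have key : ∀ {y : Fin d → ℤ}, x ∈ cell h y → ∀ j, ⌊x j / h⌋ = y j := by
    intro y hy j
    have := hy j trivial
    exact Int.floor_eq_iff.2 ⟨(le_div_iff₀ hh).2 this.1, (div_lt_iff₀ hh).2 this.2⟩
  funext j
  rw [← key hx j, key hx' j]

/-- Finitely many cells of a grid suffice to separate all separated pairs of cubes. -/
lemma exists_cells (d : ℕ) {n : ℕ} (hn : 1 ≤ n) :
    ∃ (h : ℝ) (N : ℕ) (z : Fin (N + 1) → Fin d → ℤ), 0 < h ∧ Function.Injective z ∧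
      ∀ a b s, Separated n a b s →
        ∃ q, cell h (z q) ⊆ cube a s ∧ Disjoint (cell h (z q)) (cube b s) := by
  have hn0 : (0 : ℝ) < n := by exact_mod_cast hn
  set R : ℤ := 2 * n * n
  set S : Finset (Fin d → ℤ) := Fintype.piFinset fun _ => Finset.Icc (-R) R
  have hS : 0 < S.card := by
    refine Finset.card_pos.2 ⟨0, Fintype.mem_piFinset.2 fun j => Finset.mem_Icc.2 ?_⟩
    have : 0 ≤ R := by positivity
    exact ⟨by simpa using this, by simpa using this⟩
  obtain ⟨N, hN⟩ : ∃ N, S.card = N + 1 := ⟨S.card - 1, by omega⟩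
  set e := S.equivFinOfCardEq hN
  -- Two mesh widths make `1 / n`, the lower bound for both the side and the separation. The first
  -- cell above `a` therefore fits in the first cube and ends before `b j` in the separating
  -- coordinate.
  set h : ℝ := 1 / (2 * n)
  have hh : 0 < h := by positivity
  have hh2 : 2 * h = 1 / n := by simp only [h]; field_simp
  refine ⟨h, N, fun q => (e.symm q : Fin d → ℤ), hh,
    fun q q' hq => e.symm.injective (Subtype.ext hq), ?_⟩
  rintro a b s ⟨ha, hb, hs, j, hj⟩
  set z : Fin d → ℤ := fun j => ⌈a j / h⌉
  have hz : z ∈ S := by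
    refine Fintype.mem_piFinset.2 fun j => Finset.mem_Icc.2 ⟨?_, ?_⟩
    · refine Int.le_ceil_iff.2 ?_
      have h1 := ha.1 j
      rw [lt_div_iff₀ hh]
      have h2 : ((-R : ℤ) : ℝ) * h = -n := by
        simp only [R, h]; push_cast; field_simp
      rw [sub_mul, h2]; linarith
    · refine Int.ceil_le.2 ?_
      rw [div_le_iff₀ hh]
      have h2 : (R : ℝ) * h = n := by
        simp only [R, h]; push_cast; field_simp
      rw [h2]; exact ha.2 j
  have hlo : ∀ j, a j ≤ z j * h := fun j => (div_le_iff₀ hh).1 (Int.le_ceil _)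
  have hhi : ∀ j, ((z j : ℝ) + 1) * h < a j + 1 / n := by
    intro j
    have h1 : (z j : ℝ) < a j / h + 1 := Int.ceil_lt_add_one _
    have h2 : (z j : ℝ) * h < a j + h := by
      calc (z j : ℝ) * h < (a j / h + 1) * h := by gcongr
        _ = a j + h := by field_simp
    rw [add_mul, ← hh2]; linarith
  refine ⟨e ⟨z, hz⟩, ?_, ?_⟩ <;> simp only [Equiv.symm_apply_apply]
  · intro x hx
    refine ⟨fun j => (hlo j).trans (hx j trivial).1, fun j => ?_⟩
    have := (hx j trivial).2; have := hhi j; have := hs.1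
    change x j ≤ a j + s
    linarith
  · refine Set.disjoint_left.2 fun x hx hx' => ?_
    have := (hx j trivial).2; have := hhi j; have := hx'.1 j
    linarith

/-! ### Perturbation by recoloring slabs -/

open Classical in
/-- The coloring obtained from `f` by giving color `c l` to the set `E l`, for every `l`. -/
noncomputable def recolor {d k : ℕ} {ι : Type*} [Fintype ι] (f : Coloring d k)
    (E : ι → Set (Fin d → ℝ)) (hE : ∀ l, MeasurableSet (E l))
    (hdisj : ∀ l l' x, x ∈ E l → x ∈ E l' → l = l') (c : ι → Fin k) : Coloring d k where
  toFun x := if h : ∃ l, x ∈ E l then c h.choose else f.toFun x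
  measurable_class i := by
    have hm : NullMeasurableSet
        ((f.toFun ⁻¹' {i} \ ⋃ l, E l) ∪ ⋃ l, ⋃ (_ : c l = i), E l) volume :=
      ((f.measurable_class i).diff (MeasurableSet.iUnion hE).nullMeasurableSet).union
        (MeasurableSet.iUnion fun l => MeasurableSet.iUnion fun _ => hE l).nullMeasurableSet
    convert hm using 1
    ext x
    by_cases h : ∃ l, x ∈ E l
    · have h2 : ∀ l, x ∈ E l ↔ l = h.choose := fun l =>
        ⟨fun hl => hdisj _ _ x hl h.choose_spec, fun hl => hl ▸ h.choose_spec⟩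
      have h3 : (∃ l, c l = i ∧ x ∈ E l) ↔ c h.choose = i :=
        ⟨fun ⟨l, hl, hx⟩ => (h2 l).1 hx ▸ hl, fun hc => ⟨_, hc, h.choose_spec⟩⟩
      rw [Set.mem_preimage, Set.mem_singleton_iff, dif_pos h, ← h3]
      simp only [Set.mem_union, Set.mem_sdiff, Set.mem_iUnion, h, not_true, and_false, false_or,
        exists_prop]
    · have h2 : ∀ l, x ∉ E l := fun l hl => h ⟨l, hl⟩
      simp [h2]

section recolor

variable {d k : ℕ} {ι : Type*} [Fintype ι] (f : Coloring d k)
    (E : ι → Set (Fin d → ℝ)) (hE : ∀ l, MeasurableSet (E l))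
    (hdisj : ∀ l l' x, x ∈ E l → x ∈ E l' → l = l')

lemma recolor_of_mem (c : ι → Fin k) {l : ι} {x : Fin d → ℝ} (hx : x ∈ E l) :
    (recolor f E hE hdisj c).toFun x = c l := by
  have h : ∃ l, x ∈ E l := ⟨l, hx⟩
  simp only [recolor, dif_pos h]
  rw [hdisj _ _ x h.choose_spec hx]

lemma recolor_of_notMem (c : ι → Fin k) {x : Fin d → ℝ} (hx : ∀ l, x ∉ E l) :
    (recolor f E hE hdisj c).toFun x = f.toFun x := by
  have h : ¬ ∃ l, x ∈ E l := fun ⟨l, hl⟩ => hx l hl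
  simp only [recolor, dif_neg h]

end recolor

/-- The `l`-th slab of thickness `w`, orthogonal to the coordinate `j₀`, of a grid cell. -/
def slab {d : ℕ} (j₀ : Fin d) (h w : ℝ) (z : Fin d → ℤ) (l : ℕ) : Set (Fin d → ℝ) :=
  Set.pi Set.univ fun j => if j = j₀ then Set.Ico (z j * h + l * w) (z j * h + (l + 1) * w)
    else Set.Ico (z j * h) ((z j + 1) * h)

lemma measurableSet_slab {d : ℕ} (j₀ : Fin d) (h w : ℝ) (z : Fin d → ℤ) (l : ℕ) :
    MeasurableSet (slab j₀ h w z l) := by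
  refine MeasurableSet.univ_pi fun j => ?_
  split_ifs <;> exact measurableSet_Ico

lemma volume_slab {d : ℕ} (j₀ : Fin d) {h w : ℝ} (hh : 0 ≤ h) (hw : 0 ≤ w) (z : Fin d → ℤ)
    (l : ℕ) : volume (slab j₀ h w z l) = ENNReal.ofReal (w * h ^ (d - 1)) := by
  have hj : ∀ j, volume (if j = j₀ then Set.Ico (z j * h + l * w) (z j * h + (l + 1) * w)
      else Set.Ico (z j * h) ((z j + 1) * h)) =
      ENNReal.ofReal (if j = j₀ then w else h) := by
    intro j
    split_ifs <;> rw [Real.volume_Ico] <;> congr 1 <;> ring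
  rw [slab, volume_pi_pi]
  simp_rw [hj]
  rw [← ENNReal.ofReal_prod_of_nonneg (fun j _ => by split_ifs <;> assumption)]
  congr 1
  rw [Fintype.prod_eq_mul_prod_compl j₀, if_pos rfl]
  congr 1
  rw [Finset.prod_congr rfl fun j hj => if_neg (by simpa using hj), Finset.prod_const,
    Finset.card_compl]
  simp

lemma slab_subset_cell {d : ℕ} (j₀ : Fin d) {h w : ℝ} (hw : 0 ≤ w) (z : Fin d → ℤ) {l : ℕ}
    (hl : (l + 1) * w ≤ h) : slab j₀ h w z l ⊆ cell h z := by
  refine Set.pi_mono fun j _ => ?_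
  split_ifs
  · refine Set.Ico_subset_Ico ?_ ?_
    · have : 0 ≤ l * w := by positivity
      linarith
    · rw [add_mul _ 1 h]; linarith
  · exact le_rfl

lemma eq_of_mem_slab {d : ℕ} {j₀ : Fin d} {h w : ℝ} (hw : 0 < w) {z : Fin d → ℤ} {l l' : ℕ}
    {x : Fin d → ℝ} (hx : x ∈ slab j₀ h w z l) (hx' : x ∈ slab j₀ h w z l') : l = l' := by
  have key : ∀ {m : ℕ}, x ∈ slab j₀ h w z m → ⌊(x j₀ - z j₀ * h) / w⌋ = (m : ℤ) := by
    intro m hm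
    have := hm j₀ trivial
    simp only [if_true] at this
    refine Int.floor_eq_iff.2 ⟨(le_div_iff₀ hw).2 ?_, (div_lt_iff₀ hw).2 ?_⟩
    · push_cast; linarith [this.1]
    · push_cast; linarith [this.2]
  exact_mod_cast (key hx).symm.trans (key hx')

/-- A coloring can be perturbed by an arbitrarily small amount so that the volumes of all colors
but the last one in each of finitely many cells are controlled by independent parameters. -/
lemma exists_perturbation {d p N : ℕ} (hd : 1 ≤ d) (f : Coloring d (p + 1)) {ε h : ℝ}
    (hε : 0 < ε) (hh : 0 < h) {z : Fin (N + 1) → Fin d → ℤ} (hz : Function.Injective z) :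
    ∃ κ : ℝ, 0 < κ ∧ ∀ M : ℕ, 0 < M →
      ∃ F : (Fin (N + 1) → Fin p → Fin M) → Coloring d (p + 1),
        (∀ t, dist f (F t) ≤ ε) ∧
        (∀ q t t', (∀ q', q' ≠ q → t q' = t' q') → ∀ x, x ∉ cell h (z q) →
          (F t).toFun x = (F t').toFun x) ∧
        ∃ r : Fin (N + 1) → Fin p → ℝ, ∀ t q i,
          colorVol (F t) i.castSucc (cell h (z q)) = r q i + κ / M * (t q i : ℕ) := by
  set j₀ : Fin d := ⟨0, hd⟩
  -- The first bound fits `p` layers of thickness `τ` into a cell; the second keeps the total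
  -- recolored volume below `ε`. Neither involves `M`, so `κ` does not depend on `M`.
  set τ : ℝ := min (h / (p + 1)) (ε / ((N + 1) * (p + 1) * h ^ (d - 1)))
  have hτ : 0 < τ := lt_min (by positivity) (by positivity)
  have hτh : p * τ ≤ h := by
    have h1 : τ * (p + 1) ≤ h := (le_div_iff₀ (by positivity)).1 (min_le_left _ _)
    linarith
  have hτε : (N + 1) * p * (τ * h ^ (d - 1)) ≤ ε := by
    have h1 : τ * ((N + 1) * (p + 1) * h ^ (d - 1)) ≤ ε :=
      (le_div_iff₀ (by positivity)).1 (min_le_right _ _)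
    have h2 : 0 ≤ (N + 1) * (τ * h ^ (d - 1)) := by positivity
    linarith
  refine ⟨τ * h ^ (d - 1), by positivity, fun M hM => ?_⟩
  have hM0 : (0 : ℝ) < M := by exact_mod_cast hM
  set w : ℝ := τ / M
  have hw : 0 < w := by positivity
  set E : Fin (N + 1) × Fin p × Fin M → Set (Fin d → ℝ) := fun l =>
    slab j₀ h w (z l.1) (finProdFinEquiv l.2)
  have hEm : ∀ l, MeasurableSet (E l) := fun l => measurableSet_slab _ _ _ _ _
  have hEcell : ∀ l, E l ⊆ cell h (z l.1) := by
    intro l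
    refine slab_subset_cell j₀ hw.le _ ?_
    have h1 : ((finProdFinEquiv l.2 : ℕ) : ℝ) + 1 ≤ p * M := by
      exact_mod_cast (finProdFinEquiv l.2).2
    calc _ ≤ (p * M : ℝ) * w := by gcongr
      _ = p * τ := by simp only [w]; field_simp
      _ ≤ h := hτh
  have hEd : ∀ l l' x, x ∈ E l → x ∈ E l' → l = l' := by
    rintro ⟨q, l⟩ ⟨q', l'⟩ x hx hx'
    obtain rfl : q = q' := hz (eq_of_mem_cell hh (hEcell _ hx) (hEcell _ hx'))
    have : (finProdFinEquiv l : ℕ) = finProdFinEquiv l' := eq_of_mem_slab hw hx hx'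
    rw [finProdFinEquiv.injective (Fin.ext this)]
  have hEv : ∀ l, volume (E l) = ENNReal.ofReal (w * h ^ (d - 1)) := fun l =>
    volume_slab j₀ hh.le hw.le _ _
  have hEv' : ∀ l, volume.real (E l) = τ * h ^ (d - 1) / M := by
    intro l
    rw [Measure.real, hEv, ENNReal.toReal_ofReal (by positivity)]
    simp only [w]; ring
  have hEtop : ∀ l, volume (E l) ≠ ⊤ := fun l => by rw [hEv]; exact ENNReal.ofReal_ne_top
  -- Each color but the last owns `M` slabs per cell. It fills the first `t q i` of them, and the
  -- last color absorbs the rest, so the recolored region is the same for all `t`.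
  set F : (Fin (N + 1) → Fin p → Fin M) → Coloring d (p + 1) := fun t =>
    recolor f E hEm hEd fun l => if l.2.2 < t l.1 l.2.1 then l.2.1.castSucc else Fin.last p
  refine ⟨F, fun t => ?_, fun q t t' htt x hx => ?_,
    fun q i => volume.real ((cell h (z q) ∩ f.toFun ⁻¹' {i.castSucc}) \ ⋃ l, E l),
    fun t q i => ?_⟩
  · have hU : volume (⋃ l, E l) ≠ ⊤ := by
      refine ne_top_of_le_ne_top ?_ (measure_iUnion_le _)
      rw [tsum_fintype]
      exact ENNReal.sum_ne_top.2 fun l _ => hEtop l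
    refine (dist_le_volume hU fun x hx => ?_).trans ?_
    · exact (recolor_of_notMem f E hEm hEd _ fun l hl => hx (Set.mem_iUnion.2 ⟨l, hl⟩)).symm
    · refine (measureReal_iUnion_fintype_le _).trans ?_
      simp_rw [hEv']
      rw [Finset.sum_const, Finset.card_univ]
      simp only [Fintype.card_prod, Fintype.card_fin, nsmul_eq_mul]
      push_cast
      refine le_trans (le_of_eq ?_) hτε
      field_simp
  · by_cases hl : ∃ l, x ∈ E l
    · obtain ⟨l, hl⟩ := hl
      simp only [F]
      rw [recolor_of_mem f E hEm hEd _ hl, recolor_of_mem f E hEm hEd _ hl, htt l.1]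
      rintro rfl
      exact hx (hEcell l hl)
    · push Not at hl
      simp only [F]
      rw [recolor_of_notMem f E hEm hEd _ hl, recolor_of_notMem f E hEm hEd _ hl]
  · have hset : cell h (z q) ∩ (F t).toFun ⁻¹' {i.castSucc} =
        ((cell h (z q) ∩ f.toFun ⁻¹' {i.castSucc}) \ ⋃ l, E l) ∪
          ⋃ j ∈ Finset.univ.filter (fun j : Fin M => j < t q i), E (q, i, j) := by
      ext x
      by_cases hl : ∃ l, x ∈ E l
      · obtain ⟨⟨q', i', j'⟩, hl⟩ := hl
        have h1 : (F t).toFun x = if j' < t q' i' then i'.castSucc else Fin.last p :=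
          recolor_of_mem f E hEm hEd _ hl
        have h2 : x ∈ ⋃ l, E l := Set.mem_iUnion.2 ⟨_, hl⟩
        simp only [Set.mem_inter_iff, Set.mem_preimage, Set.mem_singleton_iff, h1, Set.mem_union,
          Set.mem_sdiff, h2, not_true, and_false, false_or, Set.mem_iUnion, Finset.mem_filter,
          Finset.mem_univ, true_and, exists_prop]
        constructor
        · rintro ⟨hxq, hc⟩
          obtain rfl : q' = q := hz (eq_of_mem_cell hh (hEcell _ hl) hxq)
          split_ifs at hc with hj
          · obtain rfl := Fin.castSucc_injective _ hc
            exact ⟨j', hj, hl⟩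
          · exact absurd hc.symm (Fin.castSucc_lt_last i).ne
        · rintro ⟨j, hj, hxj⟩
          have := hEd _ _ x hl hxj
          simp only [Prod.mk.injEq] at this
          obtain ⟨rfl, rfl, rfl⟩ := this
          exact ⟨hEcell _ hl, if_pos hj⟩
      · push Not at hl
        have h1 : (F t).toFun x = f.toFun x := recolor_of_notMem f E hEm hEd _ hl
        simp [h1, hl]
    have hfin : volume (cell h (z q) ∩ f.toFun ⁻¹' {i.castSucc}) ≠ ⊤ :=
      measure_ne_top_of_subset Set.inter_subset_left (volume_cell_ne_top _ _)
    have hdis : Disjoint ((cell h (z q) ∩ f.toFun ⁻¹' {i.castSucc}) \ ⋃ l, E l)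
        (⋃ j ∈ Finset.univ.filter (fun j : Fin M => j < t q i), E (q, i, j)) := by
      refine Set.disjoint_left.2 fun x hx hx' => hx.2 ?_
      simp only [Set.mem_iUnion] at hx' ⊢
      obtain ⟨j, _, hj⟩ := hx'
      exact ⟨_, hj⟩
    have hmeas : MeasurableSet
        (⋃ j ∈ Finset.univ.filter (fun j : Fin M => j < t q i), E (q, i, j)) :=
      MeasurableSet.iUnion fun j => MeasurableSet.iUnion fun _ => hEm _
    have htop : volume (⋃ j ∈ Finset.univ.filter (fun j : Fin M => j < t q i), E (q, i, j)) ≠ ⊤ :=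
      ne_top_of_le_ne_top (ENNReal.sum_ne_top.2 fun l _ => hEtop _)
        (measure_biUnion_finset_le _ _)
    rw [colorVol, hset, measureReal_union hdis hmeas
      (measure_ne_top_of_subset Set.sdiff_subset hfin) htop,
      measureReal_biUnion_finset ?_ (fun j _ => hEm _) (fun j _ => hEtop _)]
    · simp_rw [hEv']
      rw [Finset.sum_const, nsmul_eq_mul, Finset.filter_gt_eq_Iio, Fin.card_Iio]
      ring
    · intro j _ j' _ hjj
      refine Set.disjoint_left.2 fun x hx hx' => hjj ?_
      have := hEd _ _ x hx hx'
      simp only [Prod.mk.injEq, true_and] at this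
      exact this

/-! ### Counting and density -/

lemma colorVol_sub_eq_of_cell_subset {d k : ℕ} {f g : Coloring d k} {i : Fin k}
    {A Q : Set (Fin d → ℝ)} (hQ : MeasurableSet Q) (hA : volume A ≠ ⊤) (hQA : Q ⊆ A)
    (hfg : ∀ x, x ∉ Q → f.toFun x = g.toFun x) :
    colorVol f i A - colorVol g i A = colorVol f i Q - colorVol g i Q := by
  have split : ∀ u : Coloring d k, colorVol u i A =
      colorVol u i Q + volume.real ((A \ Q) ∩ u.toFun ⁻¹' {i}) := by
    intro u
    have h := measureReal_inter_add_sdiff (s := A ∩ u.toFun ⁻¹' {i}) hQ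
      (measure_ne_top_of_subset Set.inter_subset_left hA)
    rw [colorVol, colorVol, ← h]
    congr 2
    · ext x
      simp only [Set.mem_inter_iff]
      exact ⟨fun h => ⟨h.2, h.1.2⟩, fun h => ⟨⟨hQA h.1, h.2⟩, h.1⟩⟩
    · ext x
      simp only [Set.mem_inter_iff, Set.mem_sdiff]
      tauto
  have hout : (A \ Q) ∩ f.toFun ⁻¹' {i} = (A \ Q) ∩ g.toFun ⁻¹' {i} := by
    ext x
    simp only [Set.mem_inter_iff, Set.mem_sdiff, Set.mem_preimage, Set.mem_singleton_iff]
    refine and_congr_right fun hx => ?_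
    rw [hfg x hx.2]
  rw [split f, split g, hout]
  ring

lemma colorVol_eq_of_disjoint {d k : ℕ} {f g : Coloring d k} {i : Fin k}
    {B Q : Set (Fin d → ℝ)} (hQB : Disjoint Q B)
    (hfg : ∀ x, x ∉ Q → f.toFun x = g.toFun x) : colorVol f i B = colorVol g i B := by
  unfold colorVol
  congr 1
  ext x
  refine and_congr_right fun hx => ?_
  rw [Set.mem_preimage, Set.mem_preimage, hfg x (Set.disjoint_right.1 hQB hx)]

lemma abs_sub_le_of_floor_eq {η x y : ℝ} (hη : 0 < η) (h : ⌊x / η⌋ = ⌊y / η⌋) :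
    |x - y| ≤ η := by
  have h1 := Int.abs_sub_lt_one_of_floor_eq_floor h
  rw [← sub_div, abs_div, abs_of_pos hη, div_lt_one hη] at h1
  exact h1.le

lemma floor_div_mem_Icc {n η x : ℝ} {R : ℤ} (hη : 0 < η) (hR : n ≤ R * η) (hx : |x| ≤ n) :
    ⌊x / η⌋ ∈ Finset.Icc (-R) R := by
  obtain ⟨h1, h2⟩ := abs_le.1 hx
  refine Finset.mem_Icc.2 ⟨Int.le_floor.2 ?_, ?_⟩
  · rw [le_div_iff₀ hη]; push_cast; linarith
  · have h3 : (⌊x / η⌋ : ℝ) ≤ R := (Int.floor_le _).trans ((div_le_iff₀ hη).2 (h2.trans hR))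
    exact_mod_cast h3

/-- Discretised parameters `t` of the cells cannot be injectively encoded by two vectors and one
number of `O(M)` values per coordinate, an index of a cell, and the parameters of the other cells. -/
lemma exists_code_collision {d N K : ℕ} (hK : 1 ≤ K) {M : ℕ}
    (hM : M = (3 * K) ^ (2 * d + 1) * (N + 1) + 1)
    (a b : (Fin (N + 1) → Fin (2 * d + 2) → Fin M) → Fin d → ℤ)
    (s : (Fin (N + 1) → Fin (2 * d + 2) → Fin M) → ℤ)
    (q : (Fin (N + 1) → Fin (2 * d + 2) → Fin M) → Fin (N + 1))
    (ha : ∀ t j, a t j ∈ Finset.Icc (-((K * M : ℕ) : ℤ)) ((K * M : ℕ) : ℤ))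
    (hb : ∀ t j, b t j ∈ Finset.Icc (-((K * M : ℕ) : ℤ)) ((K * M : ℕ) : ℤ))
    (hs : ∀ t, s t ∈ Finset.Icc (-((K * M : ℕ) : ℤ)) ((K * M : ℕ) : ℤ)) :
    ∃ t t', t ≠ t' ∧ a t = a t' ∧ b t = b t' ∧ s t = s t' ∧ q t = q t' ∧
      ∀ r, r ≠ q t → t r = t' r := by
  by_contra! hne
  set I := Finset.Icc (-((K * M : ℕ) : ℤ)) ((K * M : ℕ) : ℤ)
  have hM1 : 1 ≤ M := by omega
  have hI : I.card ≤ 3 * K * M := by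
    simp only [I, Int.card_Icc]
    have : 1 ≤ K * M := Nat.mul_pos hK hM1
    rw [mul_assoc]
    omega
  -- Without a collision, the rounded pair, the cell index and the parameters of the other cells
  -- form an injective code.
  have hcard := Finset.card_le_card_of_injOn
    (s := (Finset.univ : Finset (Fin (N + 1) → Fin (2 * d + 2) → Fin M)))
    (t := (Fintype.piFinset fun _ : Fin d => I) ×ˢ (Fintype.piFinset fun _ : Fin d => I) ×ˢ I ×ˢ
      (Finset.univ : Finset (Fin (N + 1))) ×ˢ
      (Finset.univ : Finset (Fin N → Fin (2 * d + 2) → Fin M)))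
    (fun t => (a t, b t, s t, q t, (q t).removeNth t))
    (fun t _ => by
      simp only [Finset.coe_product, Set.mem_prod, Finset.mem_coe, Fintype.mem_piFinset,
        Finset.mem_univ, and_true]
      exact ⟨ha t, hb t, hs t⟩)
    (fun t _ t' _ h => by
      simp only [Prod.mk.injEq] at h
      obtain ⟨h1, h2, h3, h4, h5⟩ := h
      by_contra htt
      obtain ⟨r, hr, hrt⟩ := hne t t' htt h1 h2 h3 h4
      obtain ⟨r', rfl⟩ := Fin.exists_succAbove_eq hr
      rw [← h4] at h5
      exact hrt (congrFun h5 r'))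
  simp only [Finset.card_univ, Finset.card_product, Fintype.card_piFinset_const, Fintype.card_fun,
    Fintype.card_fin] at hcard
  set V := M ^ (2 * d + 2)
  have hV : 0 < V := by positivity
  have h1 : V ^ (N + 1) ≤ (3 * K * M) ^ (2 * d + 1) * (N + 1) * V ^ N :=
    calc V ^ (N + 1) ≤ I.card ^ d * (I.card ^ d * (I.card * ((N + 1) * V ^ N))) := hcard
      _ = I.card ^ (2 * d + 1) * (N + 1) * V ^ N := by ring
      _ ≤ _ := by gcongr
  -- Cancelling `V ^ N` and then `M ^ (2 * d + 1)` leaves `M ≤ (3 * K) ^ (2 * d + 1) * (N + 1)`,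
  -- against the choice of `M`.
  rw [pow_succ'] at h1
  have h2 : M * M ^ (2 * d + 1) ≤ ((3 * K) ^ (2 * d + 1) * (N + 1)) * M ^ (2 * d + 1) := by
    have := Nat.le_of_mul_le_mul_right h1 (pow_pos hV N)
    calc M * M ^ (2 * d + 1) = V := by simp only [V]; ring
      _ ≤ _ := this
      _ = _ := by ring
  have h3 := Nat.le_of_mul_le_mul_right h2 (pow_pos hM1 _)
  omega

lemma dense_uniformlyDistinguishing {d : ℕ} (hd : 1 ≤ d) {n : ℕ} (hn : 1 ≤ n) :
    Dense (uniformlyDistinguishing d (2 * d + 3) n) := by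
  intro f
  rw [Metric.mem_closure_iff]
  intro ε hε
  by_contra! hfar
  obtain ⟨h, N, z, hh, hz, hcell⟩ := exists_cells d hn
  obtain ⟨L, hL, hLip⟩ := exists_colorVol_cube_le d n
  obtain ⟨κ, hκ, hpert⟩ := exists_perturbation (p := 2 * d + 2) hd f (half_pos hε) hh hz
  -- Rounding at scale `θ / M` then costs at most `κ / (4 * M)`, a quarter of one parameter step.
  set θ : ℝ := min 1 (κ / (4 * L))
  have hθ : 0 < θ := lt_min one_pos (by positivity)
  have hθL : L * θ ≤ κ / 4 := by
    calc L * θ ≤ L * (κ / (4 * L)) := by gcongr; exact min_le_right _ _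
      _ = κ / 4 := by field_simp
  -- Rounded coordinates lie in `[-K * M, K * M]` with `K` independent of `M`, so `M` can be chosen
  -- after `K`.
  set K : ℕ := max 1 ⌈n / θ⌉₊
  have hKθ : n ≤ K * θ := by
    rw [← div_le_iff₀ hθ]
    exact (Nat.le_ceil _).trans (by exact_mod_cast le_max_right _ _)
  obtain ⟨M, hM⟩ : ∃ M, M = (3 * K) ^ (2 * d + 1) * (N + 1) + 1 := ⟨_, rfl⟩
  have hM0 : 0 < M := by omega
  have hM1 : (1 : ℝ) ≤ M := by exact_mod_cast hM0
  have hMpos : (0 : ℝ) < M := by linarith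
  obtain ⟨F, hFd, hFout, r, hF⟩ := hpert M hM0
  have hbad : ∀ t, ∃ a b s, Separated n a b s ∧
      ∀ i, |colorVol (F t) i (cube a s) - colorVol (F t) i (cube b s)| < κ / (4 * M) := by
    intro t
    by_contra! hgood
    have h1 := hfar (F t) ⟨κ / (4 * M), by positivity, hgood⟩
    linarith [hFd t]
  choose a b s hsep hlt using hbad
  choose q hqA hqB using fun t => hcell _ _ _ (hsep t)
  set η : ℝ := θ / M
  have hη : 0 < η := by positivity
  have hη1 : η ≤ 1 := (div_le_one hMpos).2 ((min_le_left _ _).trans hM1)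
  have hLη : L * η ≤ κ / (4 * M) := by
    calc L * η = L * θ / M := by simp only [η]; ring
      _ ≤ κ / 4 / M := by gcongr
      _ = _ := by field_simp
  have hR : (n : ℝ) ≤ (((K * M : ℕ) : ℤ) : ℝ) * η := by
    refine hKθ.trans (le_of_eq ?_)
    simp only [η]; push_cast; field_simp
  have hs0 : ∀ t, 0 ≤ s t := fun t => le_trans (by positivity) (hsep t).2.2.1.1
  obtain ⟨t, t', htt, ha, hb, hs, hq, hr⟩ := exists_code_collision (d := d) (le_max_left 1 _) hM
    (fun t j => ⌊a t j / η⌋) (fun t j => ⌊b t j / η⌋) (fun t => ⌊s t / η⌋) q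
    (fun t j => floor_div_mem_Icc hη hR (abs_le.2 ⟨(hsep t).1.1 j, (hsep t).1.2 j⟩))
    (fun t j => floor_div_mem_Icc hη hR (abs_le.2 ⟨(hsep t).2.1.1 j, (hsep t).2.1.2 j⟩))
    (fun t => floor_div_mem_Icc hη hR (by rw [abs_of_nonneg (hs0 t)]; exact (hsep t).2.2.1.2))
  have ha' : ∀ j, |a t j - a t' j| ≤ η := fun j => abs_sub_le_of_floor_eq hη (congrFun ha j)
  have hb' : ∀ j, |b t j - b t' j| ≤ η := fun j => abs_sub_le_of_floor_eq hη (congrFun hb j)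
  have hs' : |s t - s t'| ≤ η := abs_sub_le_of_floor_eq hη hs
  have hout := hFout (q t) t t' fun q' hq' => hr q' hq'
  refine htt (funext fun q' => ?_)
  by_cases hq' : q' = q t
  swap
  · exact hr q' hq'
  subst hq'
  funext i
  -- Passing from `t` to `t'` with the cubes of `t` fixed changes the first color volume by the
  -- parameter difference times `κ / M` and leaves the second unchanged.
  have hA := colorVol_sub_eq_of_cell_subset (i := i.castSucc) (measurableSet_cell h (z (q t)))
    (volume_cube_ne_top (a t) (s t)) (hqA t) hout
  have hB : colorVol (F t) i.castSucc (cube (b t) (s t)) =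
      colorVol (F t') i.castSucc (cube (b t) (s t)) := colorVol_eq_of_disjoint (hqB t) hout
  rw [hF, hF] at hA
  have ht := abs_lt.1 (hlt t i.castSucc)
  have ht' := abs_lt.1 (hlt t' i.castSucc)
  have lip : ∀ c : (Fin (N + 1) → Fin (2 * d + 2) → Fin M) → Fin d → ℝ,
      (∀ j, |c t j - c t' j| ≤ η) →
      colorVol (F t') i.castSucc (cube (c t) (s t)) ≤
        colorVol (F t') i.castSucc (cube (c t') (s t')) + L * η ∧
      colorVol (F t') i.castSucc (cube (c t') (s t')) ≤
        colorVol (F t') i.castSucc (cube (c t) (s t)) + L * η := fun c hc =>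
    ⟨hLip _ _ _ _ _ _ _ _ (hs0 t') (hsep t').2.2.1.2 hη.le hη1 hc hs',
      hLip _ _ _ _ _ _ _ _ (hs0 t) (hsep t).2.2.1.2 hη.le hη1
        (fun j => by rw [abs_sub_comm]; exact hc j) (by rw [abs_sub_comm]; exact hs')⟩
  obtain ⟨hl1, hl2⟩ := lip a ha'
  obtain ⟨hl3, hl4⟩ := lip b hb'
  have hκM : κ / M = 4 * (κ / (4 * M)) := by field_simp
  set x : ℝ := ((t (q t) i : ℕ) : ℝ)
  set y : ℝ := ((t' (q t) i : ℕ) : ℝ)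
  have hκM0 : 0 < κ / M := by positivity
  -- Four errors of size `κ / (4 * M)` enter: the two failures to distinguish, which are strict, and
  -- the rounding of the two cubes. The integers `x` and `y` thus differ by less than 1.
  have hxy1 : κ / M * (x - y) < κ / M * 1 := by linarith
  have hxy2 : κ / M * (y - x) < κ / M * 1 := by linarith
  have h1 : x < y + 1 := by linarith [lt_of_mul_lt_mul_left hxy1 hκM0.le]
  have h2 : y < x + 1 := by linarith [lt_of_mul_lt_mul_left hxy2 hκM0.le]
  simp only [x, y] at h1 h2
  norm_cast at h1 h2
  exact Fin.ext (by omega)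

end CubeColoring

theorem mainTheorem12 (d : ℕ) (hd : 1 ≤ d) :
    (∃ f : CubeColoring.Coloring d (2 * d + 3), CubeColoring.DistinguishesCubes f) ∧
      Dense {F : CubeColoring.ColoringSpace d (2 * d + 3) |
        CubeColoring.ColoringSpace.Distinguishes F} := by
  have hdense : Dense {f : CubeColoring.Coloring d (2 * d + 3) |
      CubeColoring.DistinguishesCubes f} := by
    refine (dense_iInter_of_isOpen (fun n : ℕ =>
      CubeColoring.isOpen_uniformlyDistinguishing d (2 * d + 3) (n + 1)) fun n =>
      CubeColoring.dense_uniformlyDistinguishing hd (Nat.le_add_left 1 n)).mono ?_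
    intro f hf
    refine CubeColoring.distinguishesCubes_of_forall_mem hd fun n hn => ?_
    obtain ⟨m, rfl⟩ := Nat.exists_eq_add_of_le' hn
    exact Set.mem_iInter.1 hf m
  refine ⟨?_, ?_⟩
  · have : Nonempty (CubeColoring.Coloring d (2 * d + 3)) :=
      ⟨⟨fun _ => 0, fun i => (measurable_const (measurableSet_singleton i)).nullMeasurableSet⟩⟩
    exact hdense.nonempty
  -- Baire is applied before identification; density passes to the quotient along the continuous
  -- surjection.
  · refine (SeparationQuotient.surjective_mk.denseRange.dense_image
      SeparationQuotient.continuous_mk hdense).mono ?_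
    rintro _ ⟨f, hf, rfl⟩
    exact hf
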